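/- Let $K$ be a field and let $G$ be a finite simple graph on the vertex set $[d]=\{1,\dots,d\}$ with edge set $E(G)=\{e_1,\dots,e_n\}$. For $M\subseteq E(G)$ let $\rho(M)=\sum_{e_j\in M}\mathbf e_j\in\mathbb R^n$. A matching of $G$ is a set of pairwise non-adjacent edges, and it is perfect if it covers every vertex. Let $\mathcal M_G$ (resp. $\mathcal P_G$) be the convex hull of the vectors $\rho(M)$ where $M$ runs over all matchings (resp. all perfect matchings) of $G$. For a lattice polytope $\mathcal P\subset\mathbb R^n_{\ge 0}$ (possibly empty), the toric ideal $I_{\mathcal P}$ is the kernel of the $K$-algebra homomorphism $K[x_{\mathbf a}:\mathbf a\in\mathcal P\cap\mathbb Z^n_{\ge 0}]\to K[t_1,\dots,t_n,s]$, $x_{\mathbf a}\mapsto t_1^{a_1}\cdots t_n^{a_n}s$. It is homogeneous for $\deg x_{\mathbf a}=1$. For a homogeneous ideal $I$, let $\omega(I)$ denote the maximal degree of the minimal (homogeneous) generators of $I$, with the convention $\omega(\{0\})=2$. Then: (a) $\omega(I_{\mathcal P_G})\le\omega(I_{\mathcal M_G})$. (b) Let $G'$ be the graph on $[2d]$ obtained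 by taking two disjoint copies of $G$ and adding an edge between each vertex and its copy. Then $G'$ has $2n+d$ edges, and $\omega(I_{\mathcal M_G})\le\omega(I_{\mathcal P_{G'}})$. In particular, there exists a graph $G'$ on $[2d]$ with $2n+d$ edges such that $\omega(I_{\mathcal M_G})\le\omega(I_{\mathcal P_{G'}})$. -/

import Mathlib

noncomputable section

namespace MatchingToric

open MvPolynomial

/-- The nonnegative lattice points of a set `P` in the real vector space `ι → ℝ`. -/
def latticePoints {ι : Type*} (P : Set (ι → ℝ)) : Set (ι →₀ ℕ) :=
  {a | (fun i => (a i : ℝ)) ∈ P}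

/-- The `K`-algebra homomorphism from the polynomial ring with one variable `x_a` for each
nonnegative lattice point `a` of `P`, sending `x_a` to `t^a * s`. The variable `s` is `X none`
and the variable `t_i` is `X (some i)`. -/
def toricMap {ι : Type*} (K : Type*) [Field K] (P : Set (ι → ℝ)) :
    MvPolynomial (latticePoints P) K →ₐ[K] MvPolynomial (Option ι) K :=
  aeval fun a => (a.1.prod fun i m => X (some i) ^ m) * X none

/-- The toric ideal of `P` over the field `K`. -/
def toricIdeal {ι : Type*} (K : Type*) [Field K] (P : Set (ι → ℝ)) :
    Ideal (MvPolynomial (latticePoints P) K) :=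
  RingHom.ker (toricMap K P)

/-- `S` is a set of homogeneous generators of `I`. -/
def IsHomogeneousGenerators {σ K : Type*} [Field K] (I : Ideal (MvPolynomial σ K))
    (S : Set (MvPolynomial σ K)) : Prop :=
  (∀ f ∈ S, ∃ k : ℕ, f.IsHomogeneous k) ∧ Ideal.span S = I

/-- `f` is a minimal generator of the homogeneous ideal `I`: it belongs to some set of
homogeneous generators of `I` that is minimal under inclusion. -/
def IsMinimalGenerator {σ K : Type*} [Field K] (I : Ideal (MvPolynomial σ K))
    (f : MvPolynomial σ K) : Prop :=
  ∃ S : Set (MvPolynomial σ K), Minimal (IsHomogeneousGenerators I) S ∧ f ∈ S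

open Classical in
/-- The maximal degree of the minimal generators of a homogeneous ideal,
with the convention that it is `2` for the zero ideal. -/
def omega {σ K : Type*} [Field K] (I : Ideal (MvPolynomial σ K)) : ℕ :=
  if I = ⊥ then 2 else sSup {k | ∃ f, IsMinimalGenerator I f ∧ f.totalDegree = k}

section Graph

variable {V : Type*}

/-- A set of edges of `G` is a matching if its edges are pairwise non-adjacent, that is,
no two distinct ones share a vertex. -/
def IsMatching (G : SimpleGraph V) (M : Set G.edgeSet) : Prop :=
  ∀ e ∈ M, ∀ e' ∈ M, e ≠ e' → ∀ v : V, ¬(v ∈ e.1 ∧ v ∈ e'.1)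

/-- A matching is perfect if it covers every vertex. -/
def IsPerfectMatching (G : SimpleGraph V) (M : Set G.edgeSet) : Prop :=
  IsMatching G M ∧ ∀ v : V, ∃ e ∈ M, v ∈ e.1

/-- The `(0,1)`-vector of a set of edges. -/
def rho (G : SimpleGraph V) (M : Set G.edgeSet) : G.edgeSet → ℝ :=
  M.indicator 1

/-- The (full) matching polytope. -/
def matchingPolytope (G : SimpleGraph V) : Set (G.edgeSet → ℝ) :=
  convexHull ℝ {x | ∃ M, IsMatching G M ∧ x = rho G M}

/-- The perfect matching polytope. -/
def perfectMatchingPolytope (G : SimpleGraph V) : Set (G.edgeSet → ℝ) :=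
  convexHull ℝ {x | ∃ M, IsPerfectMatching G M ∧ x = rho G M}

end Graph

/-- Two disjoint copies of a graph on `d` vertices, with an edge added between each vertex and
its copy. The vertices `0, …, d - 1` form the first copy and `d, …, 2 * d - 1` the second one;
the copy of `v` is `v + d`. -/
def doubleGraph {d : ℕ} (G : SimpleGraph (Fin d)) : SimpleGraph (Fin (2 * d)) :=
  ((⊤ : SimpleGraph (Fin 2)).boxProd G).map finProdFinEquiv

end MatchingToric

end

/-! Both inequalities come from one principle (`omega_le_omega_of_map`): if a degree-preserving
algebra map carries a homogeneous ideal `J` without nonzero forms of degree at most 1 onto `I`, then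
images of generators of `J` generate `I`, so `omega I ≤ omega J`.

For (a), the perfect matching polytope is the face of the matching polytope on which every vertex
sum is 1. Killing the variables off a face maps the toric ideal onto that of the face
(`omega_toricIdeal_le_of_face`).

For (b), a matching `M` of `G` extends to a perfect matching of the doubled graph: two copies of
`M`, plus rungs at the uncovered vertices. This extension is affine, and restriction to the first
copy is a left inverse. Both respect the relations of the toric ideals, so renaming variables along
the restriction is onto (`omega_toricIdeal_le_of_retract`). -/

namespace MatchingToric

open MvPolynomial

/-! ### Generating degrees of homogeneous ideals. -/

section Omega

attribute [local instance] MvPolynomial.gradedAlgebra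

variable {σ τ K : Type*} [Field K]

theorem homogeneousComponent_mul_eq_zero {a f : MvPolynomial σ K} {j k : ℕ}
    (hf : f.IsHomogeneous k) (hjk : j < k) : homogeneousComponent j (a * f) = 0 := by
  classical
  ext m
  rw [coeff_homogeneousComponent, coeff_zero]
  split_ifs with hm
  · rw [coeff_mul]
    refine Finset.sum_eq_zero fun x hx => ?_
    rw [hf.coeff_eq_zero, mul_zero]
    intro hk
    rw [Finset.HasAntidiagonal.mem_antidiagonal] at hx
    have := congrArg Finsupp.degree hx
    rw [map_add] at this
    omega
  · rfl

/-- Write `g = a * f + z` with `z` in the span of the other generators. In degree `j` the term `a *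
f` vanishes, and the component of `z` stays in that homogeneous span. -/
theorem mem_span_diff_singleton {S : Set (MvPolynomial σ K)}
    (hS : ∀ f ∈ S, ∃ k : ℕ, f.IsHomogeneous k) {f g : MvPolynomial σ K} {j k : ℕ}
    (hf : f.IsHomogeneous k) (hg : g.IsHomogeneous j) (hjk : j < k) (hgS : g ∈ Ideal.span S) :
    g ∈ Ideal.span (S \ {f}) := by
  have hsub : S ⊆ insert f (S \ {f}) := by
    intro x hx
    by_cases h : x = f
    · exact Or.inl h
    · exact Or.inr ⟨hx, h⟩
  obtain ⟨a, z, hz, rfl⟩ := Ideal.mem_span_insert.mp (Ideal.span_mono hsub hgS)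
  have hhom : (Ideal.span (S \ {f})).IsHomogeneous (homogeneousSubmodule σ K) := by
    refine Ideal.homogeneous_span _ _ fun x hx => ?_
    obtain ⟨i, hi⟩ := hS x hx.1
    exact ⟨i, hi⟩
  have := homogeneousComponent_eq_self hg
  rw [map_add, homogeneousComponent_mul_eq_zero hf hjk, zero_add] at this
  rw [← this]
  exact homogeneousComponent_mem_of_mem hhom hz j

theorem ne_zero_of_minimal {I : Ideal (MvPolynomial σ K)} {S : Set (MvPolynomial σ K)}
    (hS : Minimal (IsHomogeneousGenerators I) S) {f : MvPolynomial σ K} (hf : f ∈ S) : f ≠ 0 := by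
  rintro rfl
  have h : IsHomogeneousGenerators I (S \ {0}) :=
    ⟨fun g hg => hS.1.1 g hg.1, by rw [Ideal.span_sdiff_singleton_zero, hS.1.2]⟩
  exact (hS.2 h Set.sdiff_subset hf).2 rfl

/-- A generator of degree above `N` is redundant: the elements of degree at most `N`, which already
generate `I`, lie in the span of the remaining generators. -/
theorem totalDegree_le_of_isMinimalGenerator {I : Ideal (MvPolynomial σ K)} {N : ℕ}
    (h : I ≤ Ideal.span {f | f ∈ I ∧ ∃ k ≤ N, f.IsHomogeneous k})
    {f : MvPolynomial σ K} (hf : IsMinimalGenerator I f) : f.totalDegree ≤ N := by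
  obtain ⟨S, hS, hfS⟩ := hf
  obtain ⟨k, hk⟩ := hS.1.1 f hfS
  rw [hk.totalDegree (ne_zero_of_minimal hS hfS)]
  by_contra! hlt
  have hgen : IsHomogeneousGenerators I (S \ {f}) := by
    refine ⟨fun g hg => hS.1.1 g hg.1, le_antisymm ?_ ?_⟩
    · exact (Ideal.span_mono Set.sdiff_subset).trans hS.1.2.le
    · refine h.trans (Ideal.span_le.mpr ?_)
      rintro g ⟨hgI, j, hj, hg⟩
      exact mem_span_diff_singleton hS.1.1 hk hg (hj.trans_lt hlt) (hS.1.2.symm ▸ hgI)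
  exact (hS.2 hgen Set.sdiff_subset hfS).2 rfl

theorem omega_le {I : Ideal (MvPolynomial σ K)} (hI : I ≠ ⊥) {N : ℕ}
    (h : I ≤ Ideal.span {f | f ∈ I ∧ ∃ k ≤ N, f.IsHomogeneous k}) : omega I ≤ N := by
  rw [omega, if_neg hI]
  refine csSup_le' ?_
  rintro _ ⟨f, hf, rfl⟩
  exact totalDegree_le_of_isMinimalGenerator h hf

theorem exists_finset_isHomogeneousGenerators [Finite σ] {I : Ideal (MvPolynomial σ K)}
    (hI : I.IsHomogeneous (homogeneousSubmodule σ K)) :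
    ∃ T : Finset (MvPolynomial σ K), IsHomogeneousGenerators I (T : Set (MvPolynomial σ K)) := by
  obtain ⟨S, hS⟩ := (Ideal.IsHomogeneous.iff_exists _ _).mp hI
  obtain ⟨T, hT, hspan⟩ := (Submodule.fg_span_iff_fg_span_finset_subset _).mp
    (IsNoetherian.noetherian (Ideal.span ((↑) '' S : Set (MvPolynomial σ K))))
  refine ⟨T, fun f hf => ?_, ?_⟩
  · obtain ⟨x, -, rfl⟩ := hT hf
    exact x.2
  · rw [hS]
    exact hspan.symm

/-- Inclusion of finite sets is well-founded, and subsets of a finite set are finite, so minimality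
among finite generating sets is minimality among all. -/
theorem exists_finset_minimal_isHomogeneousGenerators [Finite σ] {I : Ideal (MvPolynomial σ K)}
    (hI : I.IsHomogeneous (homogeneousSubmodule σ K)) :
    ∃ T : Finset (MvPolynomial σ K),
      Minimal (IsHomogeneousGenerators I) (T : Set (MvPolynomial σ K)) := by
  obtain ⟨T, hT⟩ := exists_minimal_of_wellFoundedLT
    (fun T : Finset (MvPolynomial σ K) => IsHomogeneousGenerators I (T : Set (MvPolynomial σ K)))
    (exists_finset_isHomogeneousGenerators hI)
  refine ⟨T, hT.1, fun S hS hST => ?_⟩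
  lift S to Finset (MvPolynomial σ K) using T.finite_toSet.subset hST
  exact_mod_cast hT.2 hS (by exact_mod_cast hST)

/-- A homogeneous ideal is generated by its homogeneous elements of degree at most `omega`. -/
theorem le_span_omega [Finite σ] {I : Ideal (MvPolynomial σ K)}
    (hI : I.IsHomogeneous (homogeneousSubmodule σ K)) (hbot : I ≠ ⊥) :
    I ≤ Ideal.span {f | f ∈ I ∧ ∃ k ≤ omega I, f.IsHomogeneous k} := by
  obtain ⟨T, hT⟩ := exists_finset_minimal_isHomogeneousGenerators hI
  have hmem : ∀ f ∈ T, f ∈ I := fun f hf => hT.1.2 ▸ Ideal.subset_span hf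
  have hhom : ∀ f ∈ T, f.IsHomogeneous f.totalDegree := fun f hf => by
    obtain ⟨k, hk⟩ := hT.1.1 f hf
    rwa [hk.totalDegree (ne_zero_of_minimal hT hf)]
  -- An unbounded `sSup` in `ℕ` would be 0. The one finite set `T` bounds the degrees occurring in
  -- every minimal generating set.
  have hbdd : BddAbove {k | ∃ f, IsMinimalGenerator I f ∧ f.totalDegree = k} := by
    refine ⟨T.sup totalDegree, ?_⟩
    rintro _ ⟨f, hf, rfl⟩
    refine totalDegree_le_of_isMinimalGenerator ?_ hf
    conv_lhs => rw [← hT.1.2]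
    exact Ideal.span_mono fun g hg => ⟨hmem g hg, _, Finset.le_sup hg, hhom g hg⟩
  conv_lhs => rw [← hT.1.2]
  refine Ideal.span_mono fun f hf => ⟨hmem f hf, _, ?_, hhom f hf⟩
  rw [omega, if_neg hbot]
  exact le_csSup hbdd ⟨f, ⟨_, hT, hf⟩, rfl⟩

/-- If a homogeneous ideal without linear forms is mapped onto another ideal by a surjective
homomorphism preserving degrees, then `omega` does not increase. -/
theorem omega_le_omega_of_map [Finite τ] {I : Ideal (MvPolynomial σ K)}
    {J : Ideal (MvPolynomial τ K)} (hJ : J.IsHomogeneous (homogeneousSubmodule τ K))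
    (hlin : ∀ f ∈ J, ∀ k ≤ 1, f.IsHomogeneous k → f = 0)
    (r : MvPolynomial τ K →ₐ[K] MvPolynomial σ K)
    (hr : ∀ (f : MvPolynomial τ K) (k : ℕ), f.IsHomogeneous k → (r f).IsHomogeneous k)
    (hIJ : J.map r = I) : omega I ≤ omega J := by
  by_cases hJbot : J = ⊥
  · subst hJbot
    rw [Ideal.map_bot] at hIJ
    simp [omega, ← hIJ]
  by_cases hI : I = ⊥
  -- The convention gives 2 here, so `omega J` must be at least 2: otherwise `J` would be generated
  -- by forms of degree at most 1, all of which are zero.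
  · have h2 : omega I = 2 := by rw [omega, if_pos hI]
    rw [h2]
    by_contra! hlt
    refine hJbot (le_bot_iff.mp ((le_span_omega hJ hJbot).trans (Ideal.span_le.mpr ?_)))
    rintro f ⟨hf, k, hk, hfk⟩
    exact hlin f hf k (by omega) hfk
  · refine omega_le hI ?_
    conv_lhs => rw [← hIJ]
    refine (Ideal.map_mono (le_span_omega hJ hJbot)).trans ?_
    rw [Ideal.map_span]
    refine Ideal.span_mono ?_
    rintro _ ⟨f, ⟨hf, k, hk, hfk⟩, rfl⟩
    exact ⟨hIJ ▸ Ideal.mem_map_of_mem r hf, k, hk, hr f k hfk⟩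

end Omega

/-! ### Toric ideals, retracts and faces. -/

section Toric

attribute [local instance] MvPolynomial.gradedAlgebra

variable {ι κ K : Type*} [Field K]

/-- The exponent of the image of the monomial `x ^ c` under the toric map. -/
noncomputable def toricExponent (A : Set (ι →₀ ℕ)) : (A →₀ ℕ) →ₗ[ℕ] (Option ι →₀ ℕ) :=
  Finsupp.linearCombination ℕ fun a : A => a.1.embDomain .some + Finsupp.single none 1

theorem toricExponent_none (A : Set (ι →₀ ℕ)) (c : A →₀ ℕ) :
    toricExponent A c none = c.sum fun _ m => m := by
  rw [toricExponent, Finsupp.linearCombination_apply, Finsupp.sum_apply]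
  refine Finsupp.sum_congr fun a _ => ?_
  have : (a.1.embDomain Function.Embedding.some) none = 0 :=
    Finsupp.embDomain_of_notMem_range _ _ _ (by simp)
  simp [this]

theorem toricExponent_some (A : Set (ι →₀ ℕ)) (c : A →₀ ℕ) (i : ι) :
    toricExponent A c (some i) = c.sum fun a m => m * a.1 i := by
  rw [toricExponent, Finsupp.linearCombination_apply, Finsupp.sum_apply]
  refine Finsupp.sum_congr fun a _ => ?_
  have : (a.1.embDomain Function.Embedding.some) (some i) = a.1 i :=
    Finsupp.embDomain_apply_self Function.Embedding.some _ _
  simp [this]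

theorem toricMap_monomial (P : Set (ι → ℝ)) (c : latticePoints P →₀ ℕ) (k : K) :
    toricMap K P (monomial c k) = monomial (toricExponent _ c) k := by
  have key : ∀ a : latticePoints P,
      ((a.1.prod fun i m => X (some i) ^ m) * X none : MvPolynomial (Option ι) K) =
        monomial (a.1.embDomain .some + Finsupp.single none 1) 1 := by
    intro a
    rw [show (1 : K) = 1 * 1 from (mul_one 1).symm, ← monomial_mul,
      monomial_eq (s := a.1.embDomain _), Finsupp.prod_embDomain]
    simp [X]
  rw [toricMap, aeval_monomial]
  simp only [key, monomial_pow, one_pow]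
  rw [toricExponent, Finsupp.linearCombination_apply, monomial_finsupp_sum_index]
  rfl

theorem weightedHomogeneousComponent_monomial {σ M : Type*} [AddCommMonoid M] [DecidableEq M]
    (w : σ → M) (n : M) (d : σ →₀ ℕ) (k : K) :
    weightedHomogeneousComponent w n (monomial d k) =
      if Finsupp.weight w d = n then monomial d k else 0 := by
  classical
  ext m
  rw [coeff_weightedHomogeneousComponent, coeff_monomial]
  by_cases h : d = m
  · subst h
    rw [if_pos rfl]
    split_ifs <;> simp
  · split_ifs <;> simp [coeff_monomial, h]

theorem toricIdeal_isHomogeneous (P : Set (ι → ℝ)) :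
    (toricIdeal K P).IsHomogeneous (homogeneousSubmodule (latticePoints P) K) := by
  classical
  -- This weight reads off the exponent of `s`, which equals the degree of the source monomial, so
  -- the toric map intertwines the two gradings.
  let w : Option ι → ℕ := fun o => o.elim 1 fun _ => 0
  have hw : ∀ c : latticePoints P →₀ ℕ, Finsupp.weight w (toricExponent _ c) = c.degree := by
    intro c
    have hnone : ∀ m : Option ι →₀ ℕ, Finsupp.weight w m = m none := by
      intro m
      induction m using Finsupp.induction_linear with
      | zero => simp
      | add a b ha hb => simp [ha, hb]
      | single o m => cases o <;> simp [w, Finsupp.weight_single]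
    rw [hnone, toricExponent_none]
    rfl
  have key : ∀ (k : ℕ) (f : MvPolynomial (latticePoints P) K),
      toricMap K P (homogeneousComponent k f) =
        weightedHomogeneousComponent w k (toricMap K P f) := by
    intro k f
    induction f using MvPolynomial.induction_on' with
    | add p q hp hq => simp only [map_add, hp, hq]
    | monomial c a =>
      rw [toricMap_monomial, weightedHomogeneousComponent_monomial, hw, homogeneousComponent,
        weightedHomogeneousComponent_monomial,
        show Finsupp.weight (1 : latticePoints P → ℕ) c = c.degree from
          (DFunLike.congr_fun Finsupp.degree_eq_weight_one c).symm]
      split_ifs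
      · exact toricMap_monomial P c a
      · exact map_zero _
  intro k f hf
  have : ((DirectSum.decompose (homogeneousSubmodule (latticePoints P) K) f k :
      MvPolynomial (latticePoints P) K)) = homogeneousComponent k f :=
    decomposition.decompose'_apply f k
  rw [this, toricIdeal, RingHom.mem_ker, key]
  rw [toricIdeal, RingHom.mem_ker] at hf
  rw [hf, map_zero]

/-- Distinct monomials of the same degree at most 1 have distinct images, since `t^a * s` determines
`a`; hence no cancellation can occur. -/
theorem eq_zero_of_mem_toricIdeal {P : Set (ι → ℝ)} {f : MvPolynomial (latticePoints P) K}
    (hf : f ∈ toricIdeal K P) {k : ℕ} (hk : k ≤ 1) (hfk : f.IsHomogeneous k) : f = 0 := by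
  classical
  have hinj : Set.InjOn (toricExponent (latticePoints P)) f.support := by
    intro c hc c' hc' h
    have hdeg : c.degree = k := (hfk.degree_eq_sum_deg_support hc).symm
    have hdeg' : c'.degree = k := (hfk.degree_eq_sum_deg_support hc').symm
    obtain rfl | rfl : k = 0 ∨ k = 1 := by omega
    · rw [Finsupp.degree_eq_zero_iff] at hdeg hdeg'
      rw [hdeg, hdeg']
    · obtain ⟨a, rfl⟩ := (Finsupp.sum_eq_one_iff _).mp hdeg
      obtain ⟨b, rfl⟩ := (Finsupp.sum_eq_one_iff _).mp hdeg'
      have hab : a = b := by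
        ext i
        have := DFunLike.congr_fun h (some i)
        simpa [toricExponent_some] using this
      rw [hab]
  ext c
  rw [coeff_zero]
  by_contra hc
  rw [toricIdeal, RingHom.mem_ker, f.as_sum, map_sum] at hf
  have := congrArg (coeff (toricExponent _ c)) hf
  simp only [toricMap_monomial, coeff_sum, coeff_monomial, coeff_zero] at this
  rw [Finset.sum_eq_single c] at this
  · simp at this; exact hc this
  · intro b hb hbc
    rw [if_neg fun h => hbc (hinj hb (mem_support_iff.mpr hc) h)]
  · intro h
    exact absurd (mem_support_iff.mpr hc) h

/-- By `hq`, the exponent after renaming depends only on the exponent before it, so renaming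
descends to a map of target monomials. Its linear extension `L` suffices; multiplicativity is not
needed. -/
theorem rename_mem_toricIdeal {P : Set (ι → ℝ)} {Q : Set (κ → ℝ)}
    (q : latticePoints P → latticePoints Q)
    (hq : ∀ c c', toricExponent (latticePoints P) c = toricExponent _ c' →
      toricExponent _ (c.mapDomain q) = toricExponent _ (c'.mapDomain q))
    {f : MvPolynomial (latticePoints P) K} (hf : f ∈ toricIdeal K P) :
    rename q f ∈ toricIdeal K Q := by
  obtain ⟨g, hg⟩ : ∃ g : (Option ι →₀ ℕ) → (Option κ →₀ ℕ), ∀ c : latticePoints P →₀ ℕ,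
      toricExponent _ (c.mapDomain q) = g (toricExponent _ c) := by
    have : Function.FactorsThrough (fun c => toricExponent _ (c.mapDomain q))
        (toricExponent (latticePoints P)) := fun c c' h => hq c c' h
    exact ⟨Function.extend _ _ 0, fun c => (this.extend_apply 0 c).symm⟩
  let L : MvPolynomial (Option ι) K →ₗ[K] MvPolynomial (Option κ) K :=
    (basisMonomials (Option ι) K).constr K fun m => monomial (g m) 1
  have hL : ∀ (m : Option ι →₀ ℕ) (a : K), L (monomial m a) = monomial (g m) a := by
    intro m a
    have h1 : monomial m a = a • (basisMonomials (Option ι) K m) := by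
      simp [smul_monomial]
    rw [h1, map_smul, Module.Basis.constr_basis, smul_monomial, smul_eq_mul, mul_one]
  have key : ∀ p : MvPolynomial (latticePoints P) K,
      toricMap K Q (rename q p) = L (toricMap K P p) := by
    intro p
    induction p using MvPolynomial.induction_on' with
    | add p q hp hq => simp only [map_add, hp, hq]
    | monomial c a => rw [rename_monomial, toricMap_monomial, toricMap_monomial, hL, hg]
  rw [toricIdeal, RingHom.mem_ker] at hf ⊢
  rw [key, hf, map_zero]

/-- A retract of lattice point sets that is compatible with the toric maps does not
increase `omega`. -/
theorem omega_toricIdeal_le_of_retract {P : Set (ι → ℝ)} {Q : Set (κ → ℝ)}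
    [Finite (latticePoints Q)]
    (q : latticePoints P → latticePoints Q) (p : latticePoints Q → latticePoints P)
    (hpq : ∀ a, p (q a) = a)
    (hq : ∀ c c', toricExponent (latticePoints P) c = toricExponent _ c' →
      toricExponent _ (c.mapDomain q) = toricExponent _ (c'.mapDomain q))
    (hp : ∀ c c', toricExponent (latticePoints Q) c = toricExponent _ c' →
      toricExponent _ (c.mapDomain p) = toricExponent _ (c'.mapDomain p)) :
    omega (toricIdeal K P) ≤ omega (toricIdeal K Q) := by
  refine omega_le_omega_of_map (toricIdeal_isHomogeneous Q)
    (fun f hf k hk => eq_zero_of_mem_toricIdeal hf hk) (rename p)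
    (fun f k hf => hf.rename_isHomogeneous) (le_antisymm ?_ ?_)
  · rw [Ideal.map_le_iff_le_comap]
    intro f hf
    exact rename_mem_toricIdeal p hp hf
  · intro f hf
    have : f = rename p (rename q f) := by
      rw [rename_rename, show p ∘ q = id from funext hpq, rename_id_apply]
    rw [this]
    exact Ideal.mem_map_of_mem (rename p) (rename_mem_toricIdeal q hq hf)

/-- Passing to the face on which an integral affine form, nonnegative on all lattice points,
vanishes does not increase `omega`. -/
theorem omega_toricIdeal_le_of_face {P Q : Set (ι → ℝ)} [Finite (latticePoints Q)] (hPQ : P ⊆ Q)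
    (w : Option ι → ℤ)
    (hnonneg : ∀ a : latticePoints Q,
      0 ≤ Finsupp.weight w (toricExponent _ (Finsupp.single a 1)))
    (hface : ∀ a : latticePoints Q,
      Finsupp.weight w (toricExponent _ (Finsupp.single a 1)) = 0 ↔ a.1 ∈ latticePoints P) :
    omega (toricIdeal K P) ≤ omega (toricIdeal K Q) := by
  classical
  let i : latticePoints P → latticePoints Q := fun a => ⟨a.1, hPQ a.2⟩
  have hi : Function.Injective i := fun a b h => Subtype.ext (congrArg (fun x => x.1) h)
  have hmap : ∀ c : latticePoints P →₀ ℕ,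
      toricExponent _ (c.mapDomain i) = toricExponent _ c := by
    intro c
    rw [toricExponent, Finsupp.linearCombination_mapDomain]
    rfl
  have hweight : ∀ c : latticePoints Q →₀ ℕ, Finsupp.weight w (toricExponent _ c) =
      c.sum fun a m => (m : ℤ) * Finsupp.weight w (toricExponent _ (Finsupp.single a 1)) := by
    intro c
    conv_lhs => rw [← c.sum_single, Finsupp.sum, map_sum, map_sum]
    refine Finset.sum_congr rfl fun a _ => ?_
    rw [← mul_one (c a), ← smul_eq_mul, ← Finsupp.smul_single, map_smul, map_nsmul]
    simp
  -- The weight of an image monomial is a sum of nonnegative contributions, zero exactly when all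
  -- its variables lie on the face. So killing the other variables amounts to taking the weight-zero
  -- component.
  have hker : ∀ f : MvPolynomial (latticePoints Q) K,
      toricMap K P (killCompl hi f) = weightedHomogeneousComponent w 0 (toricMap K Q f) := by
    intro f
    induction f using MvPolynomial.induction_on' with
    | add p q hp hq => simp only [map_add, hp, hq]
    | monomial c k =>
      rw [toricMap_monomial, weightedHomogeneousComponent_monomial]
      by_cases hc : ↑c.support ⊆ Set.range i
      · obtain ⟨c', rfl⟩ : ∃ c', Finsupp.mapDomain i c' = c :=
          ⟨_, Finsupp.mapDomain_comapDomain i hi c hc⟩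
        rw [killCompl_monomial_mapDomain, toricMap_monomial, hmap, if_pos]
        rw [← hmap, hweight]
        refine Finset.sum_eq_zero fun a ha => ?_
        obtain ⟨b, rfl⟩ := hc ha
        simp only [(hface (i b)).mpr b.2, mul_zero]
      · rw [killCompl_monomial_eq_zero_of_not_subset hi k hc, map_zero, if_neg]
        obtain ⟨a, ha, hai⟩ := Set.not_subset.mp hc
        rw [hweight]
        refine (Finset.sum_pos' (fun b _ => mul_nonneg (by positivity) (hnonneg b))
          ⟨a, ha, mul_pos ?_ ?_⟩).ne'
        · exact_mod_cast Nat.pos_of_ne_zero (Finsupp.mem_support_iff.mp ha)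
        · exact lt_of_le_of_ne (hnonneg a) fun h => hai ⟨⟨a.1, (hface a).mp h.symm⟩, rfl⟩
  refine omega_le_omega_of_map (toricIdeal_isHomogeneous Q)
    (fun f hf k hk => eq_zero_of_mem_toricIdeal hf hk) (killCompl hi)
    (fun f k hf => ?_) (le_antisymm ?_ ?_)
  · rw [killCompl, ← mul_one k, mul_comm]
    refine hf.aeval _ fun a => ?_
    split_ifs
    · exact isHomogeneous_X _ _
    · exact isHomogeneous_zero _ _ _
  · rw [Ideal.map_le_iff_le_comap]
    intro f hf
    rw [toricIdeal, RingHom.mem_ker] at hf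
    rw [Ideal.mem_comap, toricIdeal, RingHom.mem_ker, hker, hf, map_zero]
  · intro f hf
    rw [← killCompl_rename_app hi f]
    refine Ideal.mem_map_of_mem (killCompl hi) (rename_mem_toricIdeal i (fun c c' h => ?_) hf)
    rw [hmap, hmap, h]

end Toric

/-! ### The perfect matching polytope as a face of the matching polytope. -/

section MatchingPolytope

variable {V : Type*} (G : SimpleGraph V)

open Classical in
/-- The sum of the values of `x` at the edges incident to `v`. -/
noncomputable def vertexSum [Fintype G.edgeSet] {R : Type*} [AddCommMonoid R] (x : G.edgeSet → R)
    (v : V) : R :=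
  ∑ e : G.edgeSet with v ∈ e.1, x e

variable {G}

theorem perfectMatchingPolytope_subset :
    perfectMatchingPolytope G ⊆ matchingPolytope G :=
  convexHull_mono fun _ ⟨M, hM, hx⟩ => ⟨M, hM.1, hx⟩

theorem matchingPolytope_subset_Icc : matchingPolytope G ⊆ Set.Icc 0 1 := by
  refine convexHull_min ?_ (convex_Icc _ _)
  rintro _ ⟨M, -, rfl⟩
  refine ⟨fun e => ?_, fun e => ?_⟩
  · exact Set.indicator_nonneg (fun _ _ => zero_le_one) e
  · exact Set.indicator_le_self' (fun _ _ => zero_le_one) e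

theorem finite_latticePoints [Finite G.edgeSet] {P : Set (G.edgeSet → ℝ)}
    (hP : P ⊆ Set.Icc 0 1) : Finite (latticePoints P) := by
  classical
  refine Set.Finite.subset (Set.finite_Iic (Finsupp.equivFunOnFinite.symm (1 : G.edgeSet → ℕ)))
    fun a ha e => ?_
  have := (hP ha).2 e
  simpa using this

variable [Fintype G.edgeSet]

theorem vertexSum_add {R : Type*} [AddCommMonoid R] (x y : G.edgeSet → R) (v : V) :
    vertexSum G (x + y) v = vertexSum G x v + vertexSum G y v :=
  Finset.sum_add_distrib

theorem vertexSum_smul (c : ℝ) (x : G.edgeSet → ℝ) (v : V) :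
    vertexSum G (c • x) v = c * vertexSum G x v :=
  (Finset.mul_sum _ _ _).symm

theorem cast_vertexSum (a : G.edgeSet → ℕ) (v : V) :
    ((vertexSum G a v : ℕ) : ℝ) = vertexSum G (fun e => (a e : ℝ)) v :=
  Nat.cast_sum _ _

theorem vertexSum_rho_of_mem {M : Set G.edgeSet} (hM : IsMatching G M) {e : G.edgeSet}
    (he : e ∈ M) {v : V} (hv : v ∈ e.1) : vertexSum G (rho G M) v = 1 := by
  classical
  rw [vertexSum, Finset.sum_eq_single e]
  · simp [rho, he]
  · intro e' he' hne
    refine Set.indicator_of_notMem (fun h => ?_) _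
    exact hM e' h e he hne v ⟨(Finset.mem_filter.mp he').2, hv⟩
  · intro h
    simp [hv] at h

theorem vertexSum_rho_of_forall_notMem {M : Set G.edgeSet} {v : V}
    (hv : ∀ e ∈ M, v ∉ e.1) : vertexSum G (rho G M) v = 0 := by
  classical
  refine Finset.sum_eq_zero fun e he => Set.indicator_of_notMem (fun h => ?_) _
  exact hv e h (Finset.mem_filter.mp he).2

theorem vertexSum_rho_le {M : Set G.edgeSet} (hM : IsMatching G M) (v : V) :
    vertexSum G (rho G M) v ≤ 1 := by
  by_cases h : ∃ e ∈ M, v ∈ e.1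
  · obtain ⟨e, he, hv⟩ := h
    exact (vertexSum_rho_of_mem hM he hv).le
  · push Not at h
    rw [vertexSum_rho_of_forall_notMem h]
    exact zero_le_one

/-- Joining the inequality to the implication makes the condition convex: if a combination with
positive coefficients has all vertex sums 1, so do both terms, as neither exceeds 1. No facet
description of the polytope is needed. -/
theorem matchingPolytope_subset_setOf :
    matchingPolytope G ⊆ {x | (∀ v, vertexSum G x v ≤ 1) ∧
      ((∀ v, vertexSum G x v = 1) → x ∈ perfectMatchingPolytope G)} := by
  refine convexHull_min ?_ ?_
  · rintro _ ⟨M, hM, rfl⟩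
    refine ⟨vertexSum_rho_le hM, fun h => subset_convexHull _ _ ⟨M, ⟨hM, fun v => ?_⟩, rfl⟩⟩
    by_contra! hv
    have := h v
    rw [vertexSum_rho_of_forall_notMem hv] at this
    exact zero_ne_one this
  · intro x hx y hy a b ha hb hab
    have hsum : ∀ v, vertexSum G (a • x + b • y) v =
        a * vertexSum G x v + b * vertexSum G y v := fun v => by
      rw [vertexSum_add, vertexSum_smul, vertexSum_smul]
    refine ⟨fun v => ?_, fun h => ?_⟩
    · rw [hsum]
      nlinarith [hx.1 v, hy.1 v]
    · rcases ha.eq_or_lt with rfl | ha'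
      · obtain rfl : b = 1 := by linarith
        simp only [zero_smul, one_smul, zero_add] at h ⊢
        exact hy.2 h
      rcases hb.eq_or_lt with rfl | hb'
      · obtain rfl : a = 1 := by linarith
        simp only [zero_smul, one_smul, add_zero] at h ⊢
        exact hx.2 h
      refine convex_convexHull ℝ _ (hx.2 fun v => ?_) (hy.2 fun v => ?_) ha hb hab
      · have := h v
        rw [hsum] at this
        refine le_antisymm (hx.1 v) ?_
        nlinarith [hy.1 v]
      · have := h v
        rw [hsum] at this
        refine le_antisymm (hy.1 v) ?_
        nlinarith [hx.1 v]

theorem vertexSum_eq_one_of_mem {x : G.edgeSet → ℝ} (hx : x ∈ perfectMatchingPolytope G) (v : V) :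
    vertexSum G x v = 1 := by
  have hconv : Convex ℝ {x : G.edgeSet → ℝ | vertexSum G x v = 1} := by
    intro x hx y hy a b ha hb hab
    simp only [Set.mem_ofPred_eq] at hx hy ⊢
    rw [vertexSum_add, vertexSum_smul, vertexSum_smul, hx, hy, mul_one, mul_one, hab]
  refine convexHull_min ?_ hconv hx
  rintro _ ⟨M, hM, rfl⟩
  obtain ⟨e, he, hv⟩ := hM.2 v
  exact vertexSum_rho_of_mem hM.1 he hv

theorem vertexSum_le_one_of_mem_latticePoints {a : G.edgeSet →₀ ℕ}
    (ha : a ∈ latticePoints (matchingPolytope G)) (v : V) : vertexSum G a v ≤ 1 := by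
  have := (matchingPolytope_subset_setOf ha).1 v
  rw [← cast_vertexSum] at this
  exact_mod_cast this

theorem mem_latticePoints_perfectMatchingPolytope_iff {a : G.edgeSet →₀ ℕ}
    (ha : a ∈ latticePoints (matchingPolytope G)) :
    a ∈ latticePoints (perfectMatchingPolytope G) ↔ ∀ v, vertexSum G a v = 1 := by
  have hcast : ∀ v, vertexSum G a v = 1 ↔ vertexSum G (fun e => (a e : ℝ)) v = 1 := fun v => by
    rw [← cast_vertexSum, Nat.cast_eq_one]
  simp only [hcast]
  exact ⟨fun h v => vertexSum_eq_one_of_mem h v, (matchingPolytope_subset_setOf ha).2⟩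

theorem omega_perfectMatchingPolytope_le [Fintype V] (K : Type*) [Field K] :
    omega (toricIdeal K (perfectMatchingPolytope G)) ≤
      omega (toricIdeal K (matchingPolytope G)) := by
  classical
  have := finite_latticePoints (matchingPolytope_subset_Icc (G := G))
  -- The sum over all vertices of the slack `1 - vertexSum`, homogenized by `s`: the constant
  -- becomes the number of vertices, and each edge counts negatively once per endpoint.
  let w : Option G.edgeSet → ℤ :=
    fun o => o.elim (Fintype.card V : ℤ) fun e => -∑ v : V, if v ∈ e.1 then 1 else 0
  have hw : ∀ a : latticePoints (matchingPolytope G),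
      Finsupp.weight w (toricExponent _ (Finsupp.single a 1)) =
        ∑ v : V, (1 - ((vertexSum G a.1 v : ℕ) : ℤ)) := by
    intro a
    rw [Finsupp.weight_apply, Finsupp.sum_fintype _ _ (by simp), Fintype.sum_option,
      toricExponent_none]
    simp only [toricExponent_some, Finset.sum_sub_distrib, vertexSum]
    simp only [w, Option.elim, Nat.cast_sum, Finset.sum_filter]
    rw [Finset.sum_comm, sub_eq_add_neg, ← Finset.sum_neg_distrib]
    congr 1
    · simp
    · refine Finset.sum_congr rfl fun e _ => ?_
      simp [Finset.sum_ite, mul_comm]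
  have hnonneg : ∀ (a : latticePoints (matchingPolytope G)) (v : V),
      0 ≤ 1 - ((vertexSum G a.1 v : ℕ) : ℤ) := fun a v => by
    have := vertexSum_le_one_of_mem_latticePoints a.2 v
    omega
  refine omega_toricIdeal_le_of_face perfectMatchingPolytope_subset w (fun a => ?_) fun a => ?_
  · rw [hw]
    exact Finset.sum_nonneg fun v _ => hnonneg a v
  · rw [hw, Finset.sum_eq_zero_iff_of_nonneg fun v _ => hnonneg a v,
      mem_latticePoints_perfectMatchingPolytope_iff a.2]
    refine ⟨fun h v => ?_, fun h v _ => ?_⟩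
    · have := h v (Finset.mem_univ v)
      omega
    · rw [h v]
      simp

end MatchingPolytope

/-! ### The doubled graph and the diagonal embedding of matchings. -/

section DoubleGraph

variable {d : ℕ} (G : SimpleGraph (Fin d))

/-- The copy of the vertex `v` in the `i`-th copy of the graph. -/
def copyVertex (i : Fin 2) (v : Fin d) : Fin (2 * d) :=
  finProdFinEquiv (i, v)

theorem copyVertex_inj {i j : Fin 2} {v w : Fin d} :
    copyVertex i v = copyVertex j w ↔ i = j ∧ v = w := by
  simp [copyVertex]

theorem exists_copyVertex (x : Fin (2 * d)) : ∃ i v, x = copyVertex i v :=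
  ⟨_, _, (finProdFinEquiv.apply_symm_apply x).symm⟩

variable {G}

theorem doubleGraph_adj {i j : Fin 2} {v w : Fin d} :
    (doubleGraph G).Adj (copyVertex i v) (copyVertex j w) ↔
      (i ≠ j ∧ v = w) ∨ (G.Adj v w ∧ i = j) := by
  rw [doubleGraph, copyVertex, copyVertex]
  refine (SimpleGraph.Iso.map_adj_iff
    (SimpleGraph.Iso.map finProdFinEquiv ((⊤ : SimpleGraph (Fin 2)).boxProd G))).trans ?_
  simp [SimpleGraph.boxProd_adj]

variable (G)

/-- The copy of an edge of `G` in the `i`-th copy of the graph. -/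
def copyEdge (i : Fin 2) (e : G.edgeSet) : (doubleGraph G).edgeSet :=
  ⟨e.1.map (copyVertex i), by
    obtain ⟨e, he⟩ := e
    induction e with
    | _ v w => exact doubleGraph_adj.mpr (Or.inr ⟨he, rfl⟩)⟩

/-- The edge between a vertex and its copy. -/
def rungEdge (v : Fin d) : (doubleGraph G).edgeSet :=
  ⟨s(copyVertex 0 v, copyVertex 1 v), doubleGraph_adj.mpr (Or.inl ⟨by simp, rfl⟩)⟩

variable {G}

theorem copyVertex_mem_copyEdge {i j : Fin 2} {v : Fin d} {e : G.edgeSet} :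
    copyVertex i v ∈ (copyEdge G j e).1 ↔ i = j ∧ v ∈ e.1 := by
  rw [copyEdge, Sym2.mem_map]
  constructor
  · rintro ⟨w, hw, h⟩
    obtain ⟨rfl, rfl⟩ := copyVertex_inj.mp h
    exact ⟨rfl, hw⟩
  · rintro ⟨rfl, hv⟩
    exact ⟨v, hv, rfl⟩

theorem copyVertex_mem_rungEdge {i : Fin 2} {v w : Fin d} :
    copyVertex i v ∈ (rungEdge G w).1 ↔ v = w := by
  rw [rungEdge, Sym2.mem_iff, copyVertex_inj, copyVertex_inj]
  fin_cases i <;> simp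

variable (G)

/-- The edges of the doubled graph: two copies of every edge, and an edge for every vertex. -/
noncomputable def doubleEdgeEquiv : (Fin 2 × G.edgeSet) ⊕ Fin d ≃ (doubleGraph G).edgeSet :=
  Equiv.ofBijective (Sum.elim (fun p => copyEdge G p.1 p.2) (rungEdge G)) <| by
    -- A rung meets both copies of the graph, a copied edge only one.
    have hne : ∀ (i : Fin 2) (e : G.edgeSet) (v : Fin d), copyEdge G i e ≠ rungEdge G v := by
      intro i e v h
      have h0 := copyVertex_mem_rungEdge (G := G) (i := 0) (v := v) (w := v)
      have h1 := copyVertex_mem_rungEdge (G := G) (i := 1) (v := v) (w := v)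
      rw [← h, copyVertex_mem_copyEdge] at h0 h1
      exact zero_ne_one ((h0.mpr rfl).1.trans (h1.mpr rfl).1.symm)
    constructor
    · rintro (⟨i, e⟩ | v) (⟨j, e'⟩ | w) h
      · have hmem : ∀ k v, (k = i ∧ v ∈ e.1) ↔ (k = j ∧ v ∈ e'.1) := fun k v => by
          rw [← copyVertex_mem_copyEdge, ← copyVertex_mem_copyEdge]
          exact iff_of_eq (congrArg (fun x => copyVertex k v ∈ x.1) h)
        obtain rfl : i = j := ((hmem i _).mp ⟨rfl, Sym2.out_fst_mem e.1⟩).1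
        have : e = e' := Subtype.ext (Sym2.ext fun v => by simpa using hmem i v)
        rw [this]
      · exact absurd h (hne i e w)
      · exact absurd h.symm (hne j e' v)
      · have : copyVertex 0 v ∈ (rungEdge G v).1 := copyVertex_mem_rungEdge.mpr rfl
        rw [show rungEdge G v = rungEdge G w from h, copyVertex_mem_rungEdge] at this
        rw [this]
    · rintro ⟨e, he⟩
      induction e with
      | _ x y =>
        obtain ⟨i, v, rfl⟩ := exists_copyVertex x
        obtain ⟨j, w, rfl⟩ := exists_copyVertex y
        rcases doubleGraph_adj.mp he with ⟨hij, rfl⟩ | ⟨hvw, rfl⟩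
        · refine ⟨Sum.inr v, Subtype.ext ?_⟩
          fin_cases i <;> fin_cases j
          · exact absurd rfl hij
          · rfl
          · exact Sym2.eq_swap
          · exact absurd rfl hij
        · exact ⟨Sum.inl (i, ⟨s(v, w), hvw⟩), rfl⟩

theorem ncard_edgeSet_doubleGraph :
    (doubleGraph G).edgeSet.ncard = 2 * G.edgeSet.ncard + d := by
  rw [← Nat.card_coe_set_eq, ← Nat.card_coe_set_eq, ← Nat.card_congr (doubleEdgeEquiv G),
    Nat.card_sum, Nat.card_prod, Nat.card_fin, Nat.card_fin]

/-- The matching of the doubled graph consisting of both copies of `M` and of the rungs at the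
vertices that `M` does not cover. -/
def doubleMatching (M : Set G.edgeSet) : Set (doubleGraph G).edgeSet :=
  {e | Sum.elim (fun p : Fin 2 × G.edgeSet => p.2 ∈ M) (fun v : Fin d => ∀ e ∈ M, v ∉ e.1)
    ((doubleEdgeEquiv G).symm e)}

variable {G}

theorem isPerfectMatching_doubleMatching {M : Set G.edgeSet} (hM : IsMatching G M) :
    IsPerfectMatching (doubleGraph G) (doubleMatching G M) := by
  constructor
  · intro e he e' he' hne x hx
    obtain ⟨i, v, rfl⟩ := exists_copyVertex x
    obtain ⟨s, rfl⟩ := (doubleEdgeEquiv G).surjective e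
    obtain ⟨t, rfl⟩ := (doubleEdgeEquiv G).surjective e'
    rw [doubleMatching, Set.mem_ofPred_eq, Equiv.symm_apply_apply] at he he'
    obtain ⟨h1, h2⟩ := hx
    rcases s with ⟨j, e⟩ | u <;> rcases t with ⟨k, e'⟩ | u'
    · obtain ⟨rfl, hv⟩ := copyVertex_mem_copyEdge.mp h1
      obtain ⟨rfl, hv'⟩ := copyVertex_mem_copyEdge.mp h2
      exact hM e he e' he' (fun h => hne (by rw [h])) v ⟨hv, hv'⟩
    · obtain ⟨rfl, hv⟩ := copyVertex_mem_copyEdge.mp h1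
      obtain rfl := copyVertex_mem_rungEdge.mp h2
      exact he' e he hv
    · obtain rfl := copyVertex_mem_rungEdge.mp h1
      obtain ⟨rfl, hv⟩ := copyVertex_mem_copyEdge.mp h2
      exact he e' he' hv
    · obtain rfl := copyVertex_mem_rungEdge.mp h1
      obtain rfl := copyVertex_mem_rungEdge.mp h2
      exact hne rfl
  · intro x
    obtain ⟨i, v, rfl⟩ := exists_copyVertex x
    by_cases h : ∃ e ∈ M, v ∈ e.1
    · obtain ⟨e, he, hv⟩ := h
      refine ⟨doubleEdgeEquiv G (Sum.inl (i, e)), ?_, copyVertex_mem_copyEdge.mpr ⟨rfl, hv⟩⟩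
      rw [doubleMatching, Set.mem_ofPred_eq, Equiv.symm_apply_apply]
      exact he
    · push Not at h
      refine ⟨doubleEdgeEquiv G (Sum.inr v), ?_, copyVertex_mem_rungEdge.mpr rfl⟩
      rw [doubleMatching, Set.mem_ofPred_eq, Equiv.symm_apply_apply]
      exact h

theorem isMatching_preimage_copyEdge {N : Set (doubleGraph G).edgeSet}
    (hN : IsMatching (doubleGraph G) N) (i : Fin 2) : IsMatching G (copyEdge G i ⁻¹' N) := by
  intro e he e' he' hne v hv
  refine hN _ he _ he' (fun h => hne ?_) (copyVertex i v)
    ⟨copyVertex_mem_copyEdge.mpr ⟨rfl, hv.1⟩, copyVertex_mem_copyEdge.mpr ⟨rfl, hv.2⟩⟩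
  have := (doubleEdgeEquiv G).injective (a₁ := Sum.inl (i, e)) (a₂ := Sum.inl (i, e')) h
  simpa using this

theorem comp_copyEdge_mem_matchingPolytope {x : (doubleGraph G).edgeSet → ℝ}
    (hx : x ∈ perfectMatchingPolytope (doubleGraph G)) (i : Fin 2) :
    x ∘ copyEdge G i ∈ matchingPolytope G := by
  have hconv : Convex ℝ {x : (doubleGraph G).edgeSet → ℝ |
      x ∘ copyEdge G i ∈ matchingPolytope G} :=
    fun x hx y hy a b ha hb hab => convex_convexHull ℝ _ hx hy ha hb hab
  refine convexHull_min ?_ hconv hx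
  rintro _ ⟨N, hN, rfl⟩
  exact subset_convexHull _ _ ⟨_, isMatching_preimage_copyEdge hN.1 i, rfl⟩

/-- The restriction of lattice points of the perfect matching polytope of the doubled graph to the
first copy of the graph. -/
noncomputable def restrictPoint (a : latticePoints (perfectMatchingPolytope (doubleGraph G))) :
    latticePoints (matchingPolytope G) :=
  ⟨Finsupp.equivFunOnFinite.symm (a.1 ∘ copyEdge G 0),
    comp_copyEdge_mem_matchingPolytope a.2 0⟩

theorem toricExponent_mapDomain_none {ι κ : Type*} {A : Set (ι →₀ ℕ)} {B : Set (κ →₀ ℕ)}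
    (q : A → B) (c : A →₀ ℕ) :
    toricExponent B (c.mapDomain q) none = toricExponent A c none := by
  rw [toricExponent_none, toricExponent_none, Finsupp.sum_mapDomain_index (by simp) (by simp)]

theorem toricExponent_mapDomain_some {ι κ : Type*} {A : Set (ι →₀ ℕ)} {B : Set (κ →₀ ℕ)}
    (q : A → B) (c : A →₀ ℕ) (i : κ) :
    toricExponent B (c.mapDomain q) (some i) = c.sum fun a m => m * (q a).1 i := by
  rw [toricExponent_some, Finsupp.sum_mapDomain_index (by simp) (by simp [add_mul])]

theorem toricExponent_mapDomain_restrictPoint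
    {c c' : latticePoints (perfectMatchingPolytope (doubleGraph G)) →₀ ℕ}
    (h : toricExponent _ c = toricExponent _ c') :
    toricExponent _ (c.mapDomain restrictPoint) = toricExponent _ (c'.mapDomain restrictPoint) := by
  ext (_ | e)
  · rw [toricExponent_mapDomain_none, toricExponent_mapDomain_none, h]
  · have := DFunLike.congr_fun h (some (copyEdge G 0 e))
    rw [toricExponent_some, toricExponent_some] at this
    rw [toricExponent_mapDomain_some, toricExponent_mapDomain_some]
    exact this

variable [Fintype G.edgeSet]

/-- The extension of a weighting of the edges to the doubled graph, in which the rungs are weighted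
so that the weights at every vertex sum to `1`. -/
noncomputable def doubleWeight {R : Type*} [AddCommMonoid R] [One R] [Sub R] (x : G.edgeSet → R)
    (e : (doubleGraph G).edgeSet) : R :=
  Sum.elim (fun p : Fin 2 × G.edgeSet => x p.2) (fun v => 1 - vertexSum G x v)
    ((doubleEdgeEquiv G).symm e)

/-- For a matching, `1 - vertexSum` is the indicator of the uncovered vertices. -/
theorem doubleWeight_rho {M : Set G.edgeSet} (hM : IsMatching G M) :
    doubleWeight (rho G M) = rho (doubleGraph G) (doubleMatching G M) := by
  classical
  ext e
  rw [rho.eq_def (doubleGraph G), Set.indicator_apply, doubleWeight, doubleMatching, Set.mem_ofPred_eq]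
  rcases (doubleEdgeEquiv G).symm e with ⟨i, e⟩ | v
  · simp [rho, Set.indicator_apply]
  · by_cases h : ∃ e ∈ M, v ∈ e.1
    · obtain ⟨e, he, hv⟩ := h
      rw [if_neg fun h => h e he hv, Sum.elim_inr, vertexSum_rho_of_mem hM he hv, sub_self]
    · push Not at h
      rw [Sum.elim_inr, Sum.elim_inr, if_pos h, vertexSum_rho_of_forall_notMem h, sub_zero, Pi.one_apply]

theorem doubleWeight_mem_perfectMatchingPolytope {x : G.edgeSet → ℝ}
    (hx : x ∈ matchingPolytope G) :
    doubleWeight x ∈ perfectMatchingPolytope (doubleGraph G) := by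
  have hconv : Convex ℝ {x : G.edgeSet → ℝ |
      doubleWeight x ∈ perfectMatchingPolytope (doubleGraph G)} := by
    intro x hx y hy a b ha hb hab
    have : doubleWeight (a • x + b • y) = a • doubleWeight x + b • doubleWeight y := by
      ext e
      simp only [doubleWeight, Pi.add_apply, Pi.smul_apply, smul_eq_mul]
      rcases (doubleEdgeEquiv G).symm e with p | v
      · simp
      · simp only [Sum.elim_inr, vertexSum_add, vertexSum_smul]
        -- The extension is affine, not linear: the constant 1 on a rung is matched by `a + b = 1`.
        linear_combination -hab
    rw [Set.mem_ofPred_eq, this]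
    exact convex_convexHull ℝ _ hx hy ha hb hab
  refine convexHull_min ?_ hconv hx
  rintro _ ⟨M, hM, rfl⟩
  exact subset_convexHull _ _ ⟨_, isPerfectMatching_doubleMatching hM, doubleWeight_rho hM⟩

/-- The subtraction in `ℕ` does not truncate, because vertex sums of lattice points are at most 1.
-/
theorem cast_doubleWeight {a : G.edgeSet →₀ ℕ} (ha : a ∈ latticePoints (matchingPolytope G))
    (e : (doubleGraph G).edgeSet) :
    ((doubleWeight a e : ℕ) : ℝ) = doubleWeight (fun e => (a e : ℝ)) e := by
  simp only [doubleWeight]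
  rcases (doubleEdgeEquiv G).symm e with p | v
  · rfl
  · simp only [Sum.elim_inr]
    rw [Nat.cast_sub (vertexSum_le_one_of_mem_latticePoints ha v), cast_vertexSum, Nat.cast_one]

/-- The diagonal embedding of the lattice points of the matching polytope into those of the perfect
matching polytope of the doubled graph. -/
noncomputable def doublePoint (a : latticePoints (matchingPolytope G)) :
    latticePoints (perfectMatchingPolytope (doubleGraph G)) :=
  ⟨Finsupp.equivFunOnFinite.symm (doubleWeight a.1), by
    simp only [latticePoints, Set.mem_ofPred_eq, Finsupp.equivFunOnFinite_symm_apply_apply,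
      cast_doubleWeight a.2]
    exact doubleWeight_mem_perfectMatchingPolytope a.2⟩

theorem doubleWeight_copyEdge {R : Type*} [AddCommMonoid R] [One R] [Sub R] (x : G.edgeSet → R)
    (i : Fin 2) (e : G.edgeSet) : doubleWeight x (copyEdge G i e) = x e := by
  rw [doubleWeight, show copyEdge G i e = doubleEdgeEquiv G (Sum.inl (i, e)) from rfl,
    Equiv.symm_apply_apply, Sum.elim_inl]

theorem doubleWeight_rungEdge {R : Type*} [AddCommMonoid R] [One R] [Sub R] (x : G.edgeSet → R)
    (v : Fin d) : doubleWeight x (rungEdge G v) = 1 - vertexSum G x v := by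
  rw [doubleWeight, show rungEdge G v = doubleEdgeEquiv G (Sum.inr v) from rfl,
    Equiv.symm_apply_apply, Sum.elim_inr]

theorem restrictPoint_doublePoint (a : latticePoints (matchingPolytope G)) :
    restrictPoint (doublePoint a) = a := by
  ext e
  exact doubleWeight_copyEdge a.1 0 e

/-- Rung exponents are thus determined by the original ones, the exponent of `s` supplying the
constant 1 of each lattice point. The additive form avoids truncated subtraction. -/
theorem toricExponent_mapDomain_doublePoint_rungEdge
    (c : latticePoints (matchingPolytope G) →₀ ℕ) (v : Fin d) :
    toricExponent _ (c.mapDomain doublePoint) (some (rungEdge G v)) +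
      vertexSum G (fun e => toricExponent _ c (some e)) v = toricExponent _ c none := by
  have h1 : vertexSum G (fun e => toricExponent _ c (some e)) v =
      c.sum fun a m => m * vertexSum G a.1 v := by
    simp only [vertexSum, toricExponent_some, Finsupp.sum, Finset.mul_sum]
    exact Finset.sum_comm
  rw [h1, toricExponent_mapDomain_some, toricExponent_none, ← Finsupp.sum_add]
  refine Finsupp.sum_congr fun a _ => ?_
  have h2 : (doublePoint a).1 (rungEdge G v) = 1 - vertexSum G a.1 v :=
    doubleWeight_rungEdge a.1 v
  rw [h2, ← mul_add, Nat.sub_add_cancel (vertexSum_le_one_of_mem_latticePoints a.2 v), mul_one]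

theorem toricExponent_mapDomain_doublePoint
    {c c' : latticePoints (matchingPolytope G) →₀ ℕ}
    (h : toricExponent _ c = toricExponent _ c') :
    toricExponent _ (c.mapDomain doublePoint) = toricExponent _ (c'.mapDomain doublePoint) := by
  ext (_ | e)
  · rw [toricExponent_mapDomain_none, toricExponent_mapDomain_none, h]
  · obtain ⟨⟨i, e⟩ | v, rfl⟩ := (doubleEdgeEquiv G).surjective e
    · have h1 : ∀ a : latticePoints (matchingPolytope G),
          (doublePoint a).1 (copyEdge G i e) = a.1 e := fun a => doubleWeight_copyEdge a.1 i e
      have := DFunLike.congr_fun h (some e)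
      rw [toricExponent_some, toricExponent_some] at this
      rw [toricExponent_mapDomain_some, toricExponent_mapDomain_some]
      simp only [← h1] at this
      exact this
    · have h1 := toricExponent_mapDomain_doublePoint_rungEdge c v
      rw [h, ← toricExponent_mapDomain_doublePoint_rungEdge c' v] at h1
      exact Nat.add_right_cancel h1

theorem omega_matchingPolytope_le (K : Type*) [Field K] :
    omega (toricIdeal K (matchingPolytope G)) ≤
      omega (toricIdeal K (perfectMatchingPolytope (doubleGraph G))) :=
  have := finite_latticePoints
    ((perfectMatchingPolytope_subset (G := doubleGraph G)).trans matchingPolytope_subset_Icc)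
  omega_toricIdeal_le_of_retract doublePoint restrictPoint restrictPoint_doublePoint
    (fun _ _ => toricExponent_mapDomain_doublePoint)
    (fun _ _ => toricExponent_mapDomain_restrictPoint)

end DoubleGraph

end MatchingToric

theorem proposition5 (K : Type*) [Field K] (d n : ℕ) (G : SimpleGraph (Fin d))
    (hn : G.edgeSet.ncard = n) :
    MatchingToric.omega (MatchingToric.toricIdeal K (MatchingToric.perfectMatchingPolytope G)) ≤
        MatchingToric.omega (MatchingToric.toricIdeal K (MatchingToric.matchingPolytope G)) ∧
      (MatchingToric.doubleGraph G).edgeSet.ncard = 2 * n + d ∧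
      MatchingToric.omega (MatchingToric.toricIdeal K (MatchingToric.matchingPolytope G)) ≤
        MatchingToric.omega (MatchingToric.toricIdeal K
          (MatchingToric.perfectMatchingPolytope (MatchingToric.doubleGraph G))) := by
  have := Fintype.ofFinite G.edgeSet
  exact ⟨MatchingToric.omega_perfectMatchingPolytope_le K,
    hn ▸ MatchingToric.ncard_edgeSet_doubleGraph G, MatchingToric.omega_matchingPolytope_le K⟩
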